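/- Let $f:\mathbb{R}^n\to\mathbb{R}\cup\{+\infty\}$ be proper, lower semicontinuous and convex, and let $A\in\mathbb{R}^{m\times n}$. Let $A\triangleright f:\mathbb{R}^m\to[-\infty,+\infty]$ be the infimal postcomposition $$(A\triangleright f)(y)=\inf\{f(x): x\in\mathbb{R}^n,\ Ax=y\}\qquad(\inf\varnothing=+\infty),$$ which is called exact at $y$ if there is $x\in\mathbb{R}^n$ with $Ax=y$ and $(A\triangleright f)(y)=f(x)$. For $g:\mathbb{R}^m\to[-\infty,+\infty]$ let $$\partial g(t)=\{u\in\mathbb{R}^m: g(t)+\langle u,s-t\rangle\le g(s)\ \text{for all } s\in\mathbb{R}^m\},\qquad \mathrm{dom}\,\partial g=\{t:\partial g(t)\neq\varnothing\}.$$ A set-valued operator $T:\mathbb{R}^m\to 2^{\mathbb{R}^m}$ is monotone if $\langle x-y,u-v\rangle\ge 0$ whenever $u\in T(x)$ and $v\in T(y)$, and maximally monotone if it is monotone and its graph is not properly contained in the graph of another monotone operator. Then the problem $$\min_{x\in\mathbb{R}^n}\ f(x)+\tfrac12\|Ax-b\|^2$$ has a solution (a global minimizer) for every $b\in\mathbb{R}^m$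 if and only if both of the following hold: (i) $A\triangleright f$ is exact at every point of $\mathrm{dom}\,\partial(A\triangleright f)$; (ii) $\partial(A\triangleright f)$ is maximally monotone. -/

import Mathlib

/-- `f` maps into `ℝ ∪ {+∞}` and is proper, lower semicontinuous and convex, i.e. `f ∈ Γ₀(E)`.
Convexity of an extended-real-valued function is convexity of its epigraph in `E × ℝ`. -/
structure IsGammaZero {E : Type*} [NormedAddCommGroup E] [InnerProductSpace ℝ E]
    (f : E → EReal) : Prop where
  ne_bot : ∀ x, f x ≠ ⊥
  proper : ∃ x, f x ≠ ⊤
  lsc : LowerSemicontinuous f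
  convex : Convex ℝ {p : E × ℝ | f p.1 ≤ (p.2 : EReal)}

/-- The objective `x ↦ f x + ½‖A x - b‖²` of the regularized least-squares problem. -/
noncomputable def rlsObjective {E F : Type*} [NormedAddCommGroup E] [InnerProductSpace ℝ E]
    [NormedAddCommGroup F] [InnerProductSpace ℝ F]
    (f : E → EReal) (A : E →ₗ[ℝ] F) (b : F) (x : E) : EReal :=
  f x + ((1 / 2 * ‖A x - b‖ ^ 2 : ℝ) : EReal)

/-- The solution set (set of global minimizers) of the regularized least-squares problem. -/
def rlsSolutions {E F : Type*} [NormedAddCommGroup E] [InnerProductSpace ℝ E]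
    [NormedAddCommGroup F] [InnerProductSpace ℝ F]
    (f : E → EReal) (A : E →ₗ[ℝ] F) (b : F) : Set E :=
  {x | ∀ z, rlsObjective f A b x ≤ rlsObjective f A b z}

/-- The infimal postcomposition `A ▷ f`, `y ↦ inf {f x | A x = y}` in `[-∞, +∞]`
(the value is `+∞` when `y` is not in the range of `A`). -/
noncomputable def infPostcomp {E F : Type*} [NormedAddCommGroup E] [InnerProductSpace ℝ E]
    [NormedAddCommGroup F] [InnerProductSpace ℝ F]
    (A : E →ₗ[ℝ] F) (f : E → EReal) (y : F) : EReal :=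
  ⨅ x : {x : E // A x = y}, f x

/-- `A ▷ f` is exact at `y`: the infimum is attained, at a value in `(-∞, +∞]`. -/
def InfPostcompExactAt {E F : Type*} [NormedAddCommGroup E] [InnerProductSpace ℝ E]
    [NormedAddCommGroup F] [InnerProductSpace ℝ F]
    (A : E →ₗ[ℝ] F) (f : E → EReal) (y : F) : Prop :=
  ∃ x : E, A x = y ∧ infPostcomp A f y = f x ∧ f x ≠ ⊥

/-- The subdifferential of an extended-real-valued function:
`u ∈ ∂g(t)` iff `g t + ⟪u, s - t⟫ ≤ g s` for all `s`. -/
def subdiff {F : Type*} [NormedAddCommGroup F] [InnerProductSpace ℝ F]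
    (g : F → EReal) (t : F) : Set F :=
  {u | ∀ s, g t + ((inner ℝ u (s - t) : ℝ) : EReal) ≤ g s}

/-- The domain of a set-valued operator. -/
def opDom {F : Type*} (T : F → Set F) : Set F := {t | (T t).Nonempty}

/-- Monotonicity of a set-valued operator. -/
def IsMonotoneOp {F : Type*} [NormedAddCommGroup F] [InnerProductSpace ℝ F]
    (T : F → Set F) : Prop :=
  ∀ x y, ∀ u ∈ T x, ∀ v ∈ T y, 0 ≤ (inner ℝ (x - y) (u - v) : ℝ)

/-- Maximal monotonicity: `T` is monotone, and no monotone operator has a graph that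
properly contains the graph of `T`. -/
def IsMaximallyMonotone {F : Type*} [NormedAddCommGroup F] [InnerProductSpace ℝ F]
    (T : F → Set F) : Prop :=
  IsMonotoneOp T ∧ ∀ S : F → Set F, IsMonotoneOp S → (∀ x, T x ⊆ S x) → S = T

/-! ### Minimizing a strongly convex function over a convex set that need not be closed. -/

section ProximalPoint

variable {F : Type*} [NormedAddCommGroup F] [InnerProductSpace ℝ F]

/-! Write `T` for the subdifferential of `A ▷ f`. A point `x` solves the problem for `b` exactly
when `A ▷ f` is attained at `x` over `A x` with finite value and `b - A x ∈ T (A x)`. Solvability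
for every `b` thus makes `Id + T` surjective, which with monotonicity gives maximality; exactness at
`y` with `u ∈ T y` comes from solving for `b = y + u`. Conversely, a minimizing sequence in the
image of the epigraph is Cauchy by strong convexity. Its limit `t` may lie outside that image, but
the two estimates of `exists_minimizing_limit` make `(t, b - t)` monotonically related to the graph
of `T`. Maximality puts it in the graph, and exactness lifts `t` to a solution. -/

theorem norm_sub_sq_convexCombo (a c b : F) (l : ℝ) :
    ‖(1 - l) • a + l • c - b‖ ^ 2 =
      (1 - l) * ‖a - b‖ ^ 2 + l * ‖c - b‖ ^ 2 - l * (1 - l) * ‖a - c‖ ^ 2 := by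
  have h1 : (1 - l) • a + l • c - b = (1 - l) • (a - b) + l • (c - b) := by module
  have h2 : a - c = (a - b) - (c - b) := by abel
  rw [h1, h2, norm_add_sq_real, norm_sub_sq_real (a - b), norm_smul, norm_smul,
    real_inner_smul_left, real_inner_smul_right, mul_pow, mul_pow, Real.norm_eq_abs,
    Real.norm_eq_abs, sq_abs, sq_abs]
  ring

theorem norm_sub_sq_expand (s t b : F) :
    ‖s - b‖ ^ 2 = ‖t - b‖ ^ 2 - 2 * inner ℝ (b - t) (s - t) + ‖s - t‖ ^ 2 := by
  have h : s - b = (s - t) - (b - t) := by abel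
  rw [h, norm_sub_sq_real, real_inner_comm, norm_sub_rev t b]
  ring

/-- Strong convexity of `(s, r) ↦ r + ½‖s - b‖²` along a convex set bounded below by `μ`. -/
theorem le_convexCombo_of_forall_le {V : Set (F × ℝ)} (hV : Convex ℝ V) {b : F} {μ : ℝ}
    (hμ : ∀ p ∈ V, μ ≤ p.2 + 1 / 2 * ‖p.1 - b‖ ^ 2) {p q : F × ℝ} (hp : p ∈ V) (hq : q ∈ V)
    {l : ℝ} (h0 : 0 ≤ l) (h1 : l ≤ 1) :
    μ ≤ (1 - l) * (p.2 + 1 / 2 * ‖p.1 - b‖ ^ 2) + l * (q.2 + 1 / 2 * ‖q.1 - b‖ ^ 2)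
      - 1 / 2 * (l * (1 - l) * ‖p.1 - q.1‖ ^ 2) := by
  have h := hμ _ (hV hp hq (sub_nonneg.2 h1) h0 (by ring))
  simp only [Prod.fst_add, Prod.smul_fst, Prod.snd_add, Prod.smul_snd, smul_eq_mul,
    norm_sub_sq_convexCombo] at h
  linarith

theorem le_of_forall_Ioo_mul_le {a c d : ℝ} (h : ∀ l : ℝ, 0 < l → l < 1 → a + (1 - l) * c ≤ d) :
    a + c ≤ d := by
  have ht : Filter.Tendsto (fun l : ℝ => a + (1 - l) * c) (nhdsWithin 0 (Set.Ioi 0))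
      (nhds (a + (1 - 0) * c)) :=
    (Continuous.tendsto (by fun_prop) 0).mono_left nhdsWithin_le_nhds
  have := le_of_tendsto ht (by
    filter_upwards [Ioo_mem_nhdsGT (zero_lt_one : (0 : ℝ) < 1)] with l hl using h l hl.1 hl.2)
  simpa using this

/-- A point of a convex set minimizing `(s, r) ↦ r + ½‖s - b‖²` satisfies the first-order
optimality condition. -/
theorem inner_le_of_isMin {V : Set (F × ℝ)} (hV : Convex ℝ V) {b : F} {p : F × ℝ} (hp : p ∈ V)
    (hmin : ∀ q ∈ V, p.2 + 1 / 2 * ‖p.1 - b‖ ^ 2 ≤ q.2 + 1 / 2 * ‖q.1 - b‖ ^ 2)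
    {q : F × ℝ} (hq : q ∈ V) : p.2 + inner ℝ (b - p.1) (q.1 - p.1) ≤ q.2 := by
  have key : p.2 + 1 / 2 * ‖p.1 - b‖ ^ 2 + 1 / 2 * ‖p.1 - q.1‖ ^ 2
      ≤ q.2 + 1 / 2 * ‖q.1 - b‖ ^ 2 := by
    apply le_of_forall_Ioo_mul_le
    intro l h0 h1
    have h := le_convexCombo_of_forall_le hV hmin hp hq h0.le h1.le
    refine le_of_mul_le_mul_left ?_ h0
    linarith
  have := norm_sub_sq_expand q.1 p.1 b
  rw [norm_sub_rev p.1 q.1] at key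
  linarith

/-- The limit of a minimizing sequence of `(s, r) ↦ r + ½‖s - b‖²` over a convex set. -/
theorem exists_minimizing_limit [CompleteSpace F] {V : Set (F × ℝ)} (hV : Convex ℝ V)
    (hne : V.Nonempty) {b : F} {m : ℝ} (hm : ∀ p ∈ V, m ≤ p.2 + 1 / 2 * ‖p.1 - b‖ ^ 2) :
    ∃ (t : F) (μ : ℝ), (∀ p ∈ V, μ + 1 / 2 * ‖t - p.1‖ ^ 2 ≤ p.2 + 1 / 2 * ‖p.1 - b‖ ^ 2) ∧
      ∀ (u : F) (c : ℝ), (∀ p ∈ V, c + inner ℝ u p.1 ≤ p.2) →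
        c + inner ℝ u t ≤ μ - 1 / 2 * ‖t - b‖ ^ 2 := by
  let φ : F × ℝ → ℝ := fun p => p.2 + 1 / 2 * ‖p.1 - b‖ ^ 2
  have hbdd : BddBelow (φ '' V) := ⟨m, by rintro _ ⟨p, hp, rfl⟩; exact hm p hp⟩
  let μ := sInf (φ '' V)
  have hμ : ∀ p ∈ V, μ ≤ p.2 + 1 / 2 * ‖p.1 - b‖ ^ 2 := fun p hp =>
    csInf_le hbdd ⟨p, hp, rfl⟩
  have hseq : ∀ k : ℕ, ∃ p ∈ V, φ p < μ + 1 / ((k : ℝ) + 1) := by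
    intro k
    have hk : μ < μ + 1 / ((k : ℝ) + 1) := lt_add_of_pos_right _ (by positivity)
    obtain ⟨_, ⟨p, hp, rfl⟩, h⟩ := exists_lt_of_csInf_lt (hne.image φ) hk
    exact ⟨p, hp, h⟩
  choose p hpV hp using hseq
  have he := tendsto_one_div_add_atTop_nhds_zero_nat (𝕜 := ℝ)
  have hc : CauchySeq fun k => (p k).1 := by
    -- At the midpoint the strong convexity term is `1/8` of the squared distance; hence the factor
    -- 8.
    refine cauchySeq_of_le_tendsto_0 (fun k : ℕ => √(8 * (1 / ((k : ℝ) + 1)))) ?_ ?_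
    · intro i j N hi hj
      rw [dist_eq_norm]
      apply Real.le_sqrt_of_sq_le
      have h := le_convexCombo_of_forall_le hV hμ (hpV i) (hpV j) (l := 1 / 2)
        (by norm_num) (by norm_num)
      have h1 := hp i
      have h2 := hp j
      have h3 : 1 / ((i : ℝ) + 1) ≤ 1 / ((N : ℝ) + 1) := by gcongr
      have h4 : 1 / ((j : ℝ) + 1) ≤ 1 / ((N : ℝ) + 1) := by gcongr
      simp only [φ] at h1 h2
      linarith
    · have := (he.const_mul 8).sqrt
      simpa using this
  obtain ⟨t, ht⟩ := cauchySeq_tendsto_of_complete hc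
  refine ⟨t, μ, ?_, ?_⟩
  · intro q hq
    -- First `k → ∞` with `l` fixed, then division by `l` and `l → 0`.
    apply le_of_forall_Ioo_mul_le
    intro l h0 h1
    have hlim : Filter.Tendsto
        (fun k : ℕ => (1 - l) * (μ + 1 / ((k : ℝ) + 1)) + l * (q.2 + 1 / 2 * ‖q.1 - b‖ ^ 2)
          - 1 / 2 * (l * (1 - l) * ‖(p k).1 - q.1‖ ^ 2)) Filter.atTop
        (nhds ((1 - l) * (μ + 0) + l * (q.2 + 1 / 2 * ‖q.1 - b‖ ^ 2)
          - 1 / 2 * (l * (1 - l) * ‖t - q.1‖ ^ 2))) :=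
      (((he.const_add μ).const_mul _).add_const _).sub
        (((((ht.sub_const q.1).norm).pow 2).const_mul _).const_mul _)
    have := ge_of_tendsto' hlim (b := μ) fun k => by
      have h := le_convexCombo_of_forall_le hV hμ (hpV k) hq h0.le h1.le
      have h2 := mul_le_mul_of_nonneg_left (hp k).le (sub_nonneg.2 h1.le)
      simp only [φ] at h2
      linarith
    refine le_of_mul_le_mul_left ?_ h0
    linarith
  · intro u c hu
    have h1 : Filter.Tendsto (fun k => c + inner ℝ u (p k).1) Filter.atTop
        (nhds (c + inner ℝ u t)) := (tendsto_const_nhds.inner ht).const_add c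
    have h2 : Filter.Tendsto (fun k : ℕ => μ + 1 / ((k : ℝ) + 1) - 1 / 2 * ‖(p k).1 - b‖ ^ 2)
        Filter.atTop (nhds (μ + 0 - 1 / 2 * ‖t - b‖ ^ 2)) :=
      (he.const_add μ).sub ((((ht.sub_const b).norm).pow 2).const_mul _)
    have := le_of_tendsto_of_tendsto' h1 h2 fun k => by
      have h := hu _ (hpV k)
      have h' := hp k
      simp only [φ] at h'
      linarith
    simpa using this

end ProximalPoint

theorem EReal.coe_le_of_forall_coe {v : EReal} {c : ℝ} (h : ∀ r : ℝ, v ≤ (r : EReal) → c ≤ r) :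
    (c : EReal) ≤ v :=
  EReal.le_of_forall_lt_iff_le.1 fun r hr => EReal.coe_le_coe_iff.2 (h r hr.le)

/-! ### Subgradients of the infimal postcomposition and its proximal problem. -/

section InfPostcomp

variable {E F : Type*} [NormedAddCommGroup E] [InnerProductSpace ℝ E]
  [NormedAddCommGroup F] [InnerProductSpace ℝ F] {f : E → EReal} {A : E →ₗ[ℝ] F}

/-- The image of the epigraph of `f` under `A × id`. -/
def imageEpi (f : E → EReal) (A : E →ₗ[ℝ] F) : Set (F × ℝ) :=
  A.prodMap LinearMap.id '' {p : E × ℝ | f p.1 ≤ (p.2 : EReal)}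

theorem mk_mem_imageEpi {x : E} {r : ℝ} (h : f x ≤ (r : EReal)) : (A x, r) ∈ imageEpi f A :=
  ⟨(x, r), h, rfl⟩

theorem infPostcomp_le (x : E) : infPostcomp A f (A x) ≤ f x :=
  iInf_le (fun z : {z : E // A z = A x} => f z) ⟨x, rfl⟩

theorem IsGammaZero.convex_imageEpi (hf : IsGammaZero f) (A : E →ₗ[ℝ] F) :
    Convex ℝ (imageEpi f A) :=
  hf.convex.linear_image _

theorem IsGammaZero.exists_coe_eq (hf : IsGammaZero f) {x : E} (hx : f x ≠ ⊤) :
    ∃ r : ℝ, f x = r :=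
  ⟨(f x).toReal, (EReal.coe_toReal hx (hf.ne_bot x)).symm⟩

/-- `A ▷ f` and the image of the epigraph have the same affine minorants, so subgradients can be
handled with real numbers only. -/
theorem mem_subdiff_iff {t u : F} {c : ℝ} (hc : infPostcomp A f t = c) :
    u ∈ subdiff (infPostcomp A f) t ↔
      ∀ p ∈ imageEpi f A, c + inner ℝ u (p.1 - t) ≤ p.2 := by
  constructor
  · rintro hu _ ⟨⟨x, r⟩, hx, rfl⟩
    have h := ((hu (A x)).trans (infPostcomp_le x)).trans hx
    rw [hc] at h
    exact_mod_cast h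
  · intro h s
    rw [hc]
    refine le_iInf ?_
    rintro ⟨x, rfl⟩
    rw [← EReal.coe_add]
    exact EReal.coe_le_of_forall_coe fun r hr => h _ (mk_mem_imageEpi hr)

theorem IsGammaZero.infPostcomp_ne_top (hf : IsGammaZero f) {t u : F}
    (hu : u ∈ subdiff (infPostcomp A f) t) : infPostcomp A f t ≠ ⊤ := by
  intro ht
  obtain ⟨x, hx⟩ := hf.proper
  have h := (hu (A x)).trans (infPostcomp_le x)
  rw [ht, EReal.top_add_coe, top_le_iff] at h
  exact hx h

/-- Where the value is `⊥` every vector is a subgradient, so `hbot` is needed to add the two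
subgradient inequalities. -/
theorem isMonotoneOp_subdiff (hf : IsGammaZero f) (hbot : ∀ t, infPostcomp A f t ≠ ⊥) :
    IsMonotoneOp (subdiff (infPostcomp A f)) := by
  intro x y u hu v hv
  have hx := EReal.coe_toReal (hf.infPostcomp_ne_top hu) (hbot x)
  have hy := EReal.coe_toReal (hf.infPostcomp_ne_top hv) (hbot y)
  have h1 := hu y
  have h2 := hv x
  rw [← hx, ← hy] at h1 h2
  norm_cast at h1 h2
  rw [← neg_sub x y, inner_neg_right] at h1
  rw [real_inner_comm, inner_sub_left]
  linarith

/-- A solution `x` for `b` yields the subgradient `b - A x` of `A ▷ f` at `A x`, where `A ▷ f` is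
exact. -/
theorem IsGammaZero.of_mem_rlsSolutions (hf : IsGammaZero f) {b : F} {x : E}
    (hx : x ∈ rlsSolutions f A b) :
    ∃ c : ℝ, f x = c ∧ infPostcomp A f (A x) = c ∧
      b - A x ∈ subdiff (infPostcomp A f) (A x) := by
  have hxt : f x ≠ ⊤ := by
    intro hxt
    obtain ⟨z, hz⟩ := hf.proper
    obtain ⟨r, hr⟩ := hf.exists_coe_eq hz
    have h := hx z
    simp only [rlsObjective, hxt, hr, EReal.top_add_coe, top_le_iff, ← EReal.coe_add] at h
    exact EReal.coe_ne_top _ h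
  obtain ⟨c, hc⟩ := hf.exists_coe_eq hxt
  have key : ∀ q ∈ imageEpi f A, c + inner ℝ (b - A x) (q.1 - A x) ≤ q.2 := by
    intro q hq
    refine inner_le_of_isMin (p := (A x, c)) (hf.convex_imageEpi A) (mk_mem_imageEpi hc.le) ?_ hq
    rintro _ ⟨⟨z, r⟩, hz, rfl⟩
    have h := (hx z).trans (add_le_add_left hz _)
    simp only [rlsObjective, hc] at h
    exact_mod_cast h
  -- On the fibre over `A x` the linear term of `key` vanishes.
  have hval : infPostcomp A f (A x) = c := by
    refine le_antisymm (hc ▸ infPostcomp_le x) (le_iInf ?_)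
    rintro ⟨z, hz⟩
    refine EReal.coe_le_of_forall_coe fun r hr => ?_
    simpa [hz] using key _ (mk_mem_imageEpi hr)
  exact ⟨c, hc, hval, (mem_subdiff_iff hval).2 key⟩

theorem mem_rlsSolutions_of_sub_mem_subdiff {b : F} {x : E} {c : ℝ} (hc : f x = c)
    (hval : infPostcomp A f (A x) = c) (hu : b - A x ∈ subdiff (infPostcomp A f) (A x)) :
    x ∈ rlsSolutions f A b := by
  intro z
  have h : ((c + inner ℝ (b - A x) (A z - A x) : ℝ) : EReal) ≤ f z :=
    EReal.coe_le_of_forall_coe fun r hr => (mem_subdiff_iff hval).1 hu _ (mk_mem_imageEpi hr)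
  refine le_trans ?_ (add_le_add_left h _)
  rw [rlsObjective, hc, ← EReal.coe_add, ← EReal.coe_add, EReal.coe_le_coe_iff]
  have := norm_sub_sq_expand (A z) (A x) b
  have := sq_nonneg ‖A z - A x‖
  linarith

/-- If `Id + T` is surjective and `T` is monotone, then `T` is maximally monotone. -/
theorem IsMonotoneOp.isMaximallyMonotone {T : F → Set F} (hT : IsMonotoneOp T)
    (hsurj : ∀ b, ∃ t, b - t ∈ T t) : IsMaximallyMonotone T := by
  refine ⟨hT, fun S hS hTS => funext fun y => Set.Subset.antisymm (fun u hu => ?_) (hTS y)⟩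
  obtain ⟨t, ht⟩ := hsurj (y + u)
  have h := hS y t u hu _ (hTS t ht)
  have e : u - (y + u - t) = -(y - t) := by abel
  rw [e, inner_neg_right, real_inner_self_eq_norm_sq] at h
  have h0 : y - t = 0 := by
    rw [← norm_eq_zero]
    exact pow_eq_zero_iff two_ne_zero |>.1 (le_antisymm (by linarith) (sq_nonneg _))
  obtain rfl := sub_eq_zero.1 h0
  simpa using ht

/-- A point monotonically related to a maximally monotone operator belongs to its graph. -/
theorem IsMaximallyMonotone.mem_of_forall {T : F → Set F} (hT : IsMaximallyMonotone T) {t w : F}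
    (h : ∀ s, ∀ u ∈ T s, 0 ≤ (inner ℝ (t - s) (w - u) : ℝ)) : w ∈ T t := by
  let S : F → Set F := fun s => {u | u ∈ T s ∨ (s = t ∧ u = w)}
  have hS : IsMonotoneOp S := by
    rintro x y u (hu | ⟨rfl, rfl⟩) v (hv | ⟨rfl, rfl⟩)
    · exact hT.1 x y u hu v hv
    · rw [← neg_sub y x, ← neg_sub v u, inner_neg_neg]
      exact h x u hu
    · exact h y v hv
    · simp
  rw [← hT.2 S hS fun x u hu => Or.inl hu]
  exact Or.inr ⟨rfl, rfl⟩

theorem IsMaximallyMonotone.exists_mem {T : F → Set F} (hT : IsMaximallyMonotone T) :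
    ∃ t u, u ∈ T t := by
  by_contra! hne
  -- Any pair is vacuously related to an empty graph.
  exact hne 0 0 (hT.mem_of_forall fun s u hu => (hne s u hu).elim)

theorem IsGammaZero.exists_coe_of_exactAt (hf : IsGammaZero f) {t u : F}
    (hu : u ∈ subdiff (infPostcomp A f) t) (hex : InfPostcompExactAt A f t) :
    ∃ (x : E) (c : ℝ), A x = t ∧ f x = c ∧ infPostcomp A f t = c := by
  obtain ⟨x, hx, hval, -⟩ := hex
  obtain ⟨c, hc⟩ := hf.exists_coe_eq (hval ▸ hf.infPostcomp_ne_top hu)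
  exact ⟨x, c, hx, hc, hval.trans hc⟩

theorem IsGammaZero.forall_rlsSolutions_nonempty_iff [CompleteSpace F] (hf : IsGammaZero f) :
    (∀ b : F, (rlsSolutions f A b).Nonempty) ↔
      ((∀ y ∈ opDom (subdiff (infPostcomp A f)), InfPostcompExactAt A f y) ∧
        IsMaximallyMonotone (subdiff (infPostcomp A f))) := by
  constructor
  · intro h
    have hbot : ∀ t, infPostcomp A f t ≠ ⊥ := by
      intro t ht
      obtain ⟨x, hx⟩ := h 0
      obtain ⟨c, -, hval, hu⟩ := hf.of_mem_rlsSolutions hx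
      have := hu t
      rw [ht, hval, ← EReal.coe_add, le_bot_iff] at this
      exact EReal.coe_ne_bot _ this
    have hmono := isMonotoneOp_subdiff hf hbot
    refine ⟨?_, hmono.isMaximallyMonotone fun b => ?_⟩
    · rintro y ⟨u, hu⟩
      -- With this `b`, monotonicity reads `0 ≤ -‖y - A x‖ ^ 2`.
      obtain ⟨x, hx⟩ := h (y + u)
      obtain ⟨c, hc, hval, hv⟩ := hf.of_mem_rlsSolutions hx
      have h := hmono y (A x) u hu _ hv
      have e : u - (y + u - A x) = -(y - A x) := by abel
      rw [e, inner_neg_right, real_inner_self_eq_norm_sq] at h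
      have h0 : y - A x = 0 := by
        rw [← norm_eq_zero]
        exact pow_eq_zero_iff two_ne_zero |>.1 (le_antisymm (by linarith) (sq_nonneg _))
      obtain rfl := sub_eq_zero.1 h0
      exact ⟨x, rfl, hval.trans hc.symm, hf.ne_bot x⟩
    · obtain ⟨x, hx⟩ := h b
      obtain ⟨-, -, -, hv⟩ := hf.of_mem_rlsSolutions hx
      exact ⟨A x, hv⟩
  · rintro ⟨hex, hmax⟩ b
    obtain ⟨t₀, u₀, hu₀⟩ := hmax.exists_mem
    obtain ⟨x₀, c₀, rfl, hc₀, hval₀⟩ := hf.exists_coe_of_exactAt hu₀ (hex t₀ ⟨u₀, hu₀⟩)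
    -- One affine minorant bounds the objective below, by completing the square.
    have hlow : ∀ p ∈ imageEpi f A, c₀ + inner ℝ u₀ (b - A x₀) - 1 / 2 * ‖u₀‖ ^ 2 ≤
        p.2 + 1 / 2 * ‖p.1 - b‖ ^ 2 := by
      intro p hp
      have h1 := (mem_subdiff_iff hval₀).1 hu₀ p hp
      have e : p.1 - A x₀ = (p.1 - b) + (b - A x₀) := by abel
      rw [e, inner_add_right] at h1
      have h2 := norm_add_sq_real u₀ (p.1 - b)
      have := sq_nonneg ‖u₀ + (p.1 - b)‖
      linarith
    obtain ⟨t, μ, h1, h2⟩ := exists_minimizing_limit (hf.convex_imageEpi A)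
      ⟨_, mk_mem_imageEpi hc₀.le⟩ hlow
    have hmem : b - t ∈ subdiff (infPostcomp A f) t := by
      refine hmax.mem_of_forall fun s u hu => ?_
      obtain ⟨x, c, rfl, hc, hval⟩ := hf.exists_coe_of_exactAt hu (hex s ⟨u, hu⟩)
      -- Adding `g1` and `g2` cancels `μ` and `c`; expanding `‖A x - b‖ ^ 2` around `t` then cancels
      -- all squares.
      have g1 := h1 _ (mk_mem_imageEpi hc.le)
      have g2 := h2 u (c - inner ℝ u (A x)) fun p hp => by
        have := (mem_subdiff_iff hval).1 hu p hp
        rw [inner_sub_right] at this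
        linarith
      have g3 := norm_sub_sq_expand (A x) t b
      rw [norm_sub_rev (A x) t] at g3
      rw [← neg_sub t (A x), inner_neg_right] at g3
      rw [inner_sub_right, real_inner_comm (b - t), real_inner_comm u, inner_sub_right u]
      dsimp only at g1
      linarith
    obtain ⟨x, c, rfl, hc, hval⟩ := hf.exists_coe_of_exactAt hmem (hex t ⟨_, hmem⟩)
    exact ⟨x, mem_rlsSolutions_of_sub_mem_subdiff hc hval hmem⟩

end InfPostcomp

theorem theorem3p11 (n m : ℕ) (f : EuclideanSpace ℝ (Fin n) → EReal) (hf : IsGammaZero f)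
    (A : Matrix (Fin m) (Fin n) ℝ) :
    (∀ b : EuclideanSpace ℝ (Fin m), (rlsSolutions f (Matrix.toEuclideanLin A) b).Nonempty) ↔
      ((∀ y ∈ opDom (subdiff (infPostcomp (Matrix.toEuclideanLin A) f)),
          InfPostcompExactAt (Matrix.toEuclideanLin A) f y) ∧
        IsMaximallyMonotone (subdiff (infPostcomp (Matrix.toEuclideanLin A) f))) :=
  hf.forall_rlsSolutions_nonempty_iff
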